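/- Let $n\ge 3$ and let $(M,g)$ be a smooth $n$-dimensional Lorentzian manifold (signature $(-,+,\dots,+)$) with Levi-Civita connection $\nabla$, which is Einstein, i.e. $\mathrm{Ric}=\frac{scal}{n}\,g$. Let $V$ be a smooth Killing vector field on $M$ with $g(V,V)=-1$ everywhere and $\mathcal W(V,\cdot,\cdot,\cdot)=0$, where $\mathcal W$ is the Weyl tensor. Let $J$ be the field of endomorphisms of $TM$ defined by $J(X):=\nabla_X V$. Then for all tangent vectors $X$ and all vector fields $Y$: 1. $J(V)=0$ and $J^2(X)=\frac{scal}{n(n-1)}\big(X+g(V,X)V\big)$; 2. $(\nabla_X J)(Y)=\frac{scal}{n(n-1)}\big(g(V,Y)X-g(X,Y)V\big)$, where $(\nabla_XJ)(Y)=\nabla_X(J(Y))-J(\nabla_XY)$. -/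

import Mathlib

open Bundle FiberBundle VectorField
open scoped Manifold ContDiff

noncomputable section

/-- A smooth semi-Riemannian metric on an `n`-dimensional smooth manifold `M`. -/
structure SemiRiemannianMetric (n : ℕ) (M : Type*) [TopologicalSpace M]
    [ChartedSpace (EuclideanSpace ℝ (Fin n)) M] [IsManifold (𝓡 n) ∞ M] where
  /-- the bilinear form on each tangent space -/
  inner (x : M) : TangentSpace (𝓡 n) x →L[ℝ] TangentSpace (𝓡 n) x →L[ℝ] ℝ
  symm (x : M) (v w : TangentSpace (𝓡 n) x) : inner x v w = inner x w v
  nondegenerate (x : M) (v : TangentSpace (𝓡 n) x) (h : ∀ w, inner x v w = 0) : v = 0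
  contMDiff : ContMDiff (𝓡 n)
    ((𝓡 n).prod 𝓘(ℝ, EuclideanSpace ℝ (Fin n) →L[ℝ] EuclideanSpace ℝ (Fin n) →L[ℝ] ℝ)) ∞
    (fun x ↦ TotalSpace.mk'
      (EuclideanSpace ℝ (Fin n) →L[ℝ] EuclideanSpace ℝ (Fin n) →L[ℝ] ℝ)
      (E := fun x : M ↦ TangentSpace (𝓡 n) x →L[ℝ] TangentSpace (𝓡 n) x →L[ℝ] ℝ) x (inner x))

/-- The vector field `X` is differentiable at `x`, as a section of the tangent bundle. -/
abbrev FieldDiffAt {n : ℕ} {M : Type*} [TopologicalSpace M]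
    [ChartedSpace (EuclideanSpace ℝ (Fin n)) M] [IsManifold (𝓡 n) ∞ M]
    (X : Π x : M, TangentSpace (𝓡 n) x) (x : M) : Prop :=
  MDifferentiableAt (𝓡 n) ((𝓡 n).prod 𝓘(ℝ, EuclideanSpace ℝ (Fin n)))
    (fun y ↦ TotalSpace.mk' (EuclideanSpace ℝ (Fin n))
      (E := fun y : M ↦ TangentSpace (𝓡 n) y) y (X y)) x

namespace SemiRiemannianMetric

variable {n : ℕ} {M : Type*} [TopologicalSpace M]
  [ChartedSpace (EuclideanSpace ℝ (Fin n)) M] [IsManifold (𝓡 n) ∞ M]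
  (g : SemiRiemannianMetric n M)

/-- The metric is Lorentzian, i.e. of signature `(-, +, …, +)`: every tangent space has an
orthonormal basis with exactly one timelike vector. -/
def IsLorentzian : Prop :=
  ∀ x : M, ∃ b : Module.Basis (Fin n) ℝ (TangentSpace (𝓡 n) x), ∃ i₀ : Fin n, ∀ i j : Fin n,
    g.inner x (b i) (b j) = if i = j then (if i = i₀ then -1 else 1) else 0

instance instFiniteDimensionalTangent (x : M) :
    FiniteDimensional ℝ (TangentSpace (𝓡 n) x) :=
  inferInstanceAs (FiniteDimensional ℝ (EuclideanSpace ℝ (Fin n)))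

/-- The metric at `x` as a bilinear form. -/
def bilin (x : M) : LinearMap.BilinForm ℝ (TangentSpace (𝓡 n) x) :=
  LinearMap.mk₂ ℝ (fun v w ↦ g.inner x v w) (by simp) (by simp) (by simp) (by simp)

lemma bilin_nondegenerate (x : M) : (g.bilin x).Nondegenerate := by
  refine ⟨fun v h ↦ g.nondegenerate x v h, fun v h ↦ g.nondegenerate x v fun w ↦ ?_⟩
  rw [g.symm]
  exact h w

/-- The musical isomorphism `♯`, turning a covector `α` into the vector `α♯` with
`g(α♯, w) = α(w)` for all `w`. -/
def sharp (x : M) : (TangentSpace (𝓡 n) x →L[ℝ] ℝ) →L[ℝ] TangentSpace (𝓡 n) x :=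
  LinearMap.toContinuousLinearMap
    (((g.bilin x).toDual (g.bilin_nondegenerate x)).symm.toLinearMap ∘ₗ
      ContinuousLinearMap.coeLM ℝ)

lemma inner_sharp (x : M) (α : TangentSpace (𝓡 n) x →L[ℝ] ℝ) (w : TangentSpace (𝓡 n) x) :
    g.inner x (g.sharp x α) w = α w := by
  exact LinearMap.BilinForm.apply_toDual_symm_apply (B := g.bilin x)
    (hB := g.bilin_nondegenerate x) (f := (α : Module.Dual ℝ (TangentSpace (𝓡 n) x))) (v := w)

lemma ext_inner {x : M} {v v' : TangentSpace (𝓡 n) x}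
    (h : ∀ w, g.inner x v w = g.inner x v' w) : v = v' := by
  rw [← sub_eq_zero]
  refine g.nondegenerate x _ fun w ↦ ?_
  simp [h w]

/-- The function `g(X, Y)` for vector fields `X` and `Y`. -/
def pair (X Y : Π x : M, TangentSpace (𝓡 n) x) : M → ℝ := fun x ↦ g.inner x (X x) (Y x)

lemma mdifferentiableAt_pair {X Y : Π x : M, TangentSpace (𝓡 n) x} {x : M}
    (hX : FieldDiffAt X x) (hY : FieldDiffAt Y x) : MDifferentiableAt (𝓡 n) 𝓘(ℝ) (g.pair X Y) x := by
  have hg := (g.contMDiff x).mdifferentiableAt (by simp)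
  have := MDifferentiableAt.clm_bundle_apply₂ (F₁ := EuclideanSpace ℝ (Fin n))
    (F₂ := EuclideanSpace ℝ (Fin n)) (F₃ := ℝ) (E₃ := Bundle.Trivial M ℝ) hg hX hY
  simp only [mdifferentiableAt_totalSpace] at this
  exact this.2

/-! ### The Levi-Civita connection -/

/-- The right hand side of the Koszul formula for `2 g(∇_X Y, Z)`. -/
def koszul (X Y Z : Π x : M, TangentSpace (𝓡 n) x) (x : M) : ℝ :=
  mvfderiv (𝓡 n) (g.pair Y Z) x (X x) + mvfderiv (𝓡 n) (g.pair X Z) x (Y x) - mvfderiv (𝓡 n) (g.pair X Y) x (Z x)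
    + g.inner x (mlieBracket (𝓡 n) X Y x) (Z x)
    - g.inner x (mlieBracket (𝓡 n) X Z x) (Y x)
    - g.inner x (mlieBracket (𝓡 n) Y Z x) (X x)

lemma pair_smul_left (f : M → ℝ) (X Y : Π x : M, TangentSpace (𝓡 n) x) :
    g.pair (f • X) Y = f * g.pair X Y := by
  ext x; simp [pair]

lemma pair_smul_right (f : M → ℝ) (X Y : Π x : M, TangentSpace (𝓡 n) x) :
    g.pair X (f • Y) = f * g.pair X Y := by
  ext x; simp [pair]

lemma pair_add_left (X X' Y : Π x : M, TangentSpace (𝓡 n) x) :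
    g.pair (X + X') Y = g.pair X Y + g.pair X' Y := by
  ext x; simp [pair]

lemma pair_add_right (X Y Y' : Π x : M, TangentSpace (𝓡 n) x) :
    g.pair X (Y + Y') = g.pair X Y + g.pair X Y' := by
  ext x; simp [pair]

lemma tensorialAt_koszul_left {x : M} {Y Z : Π x : M, TangentSpace (𝓡 n) x}
    (hY : FieldDiffAt Y x) (hZ : FieldDiffAt Z x) :
    TensorialAt (𝓡 n) (EuclideanSpace ℝ (Fin n)) (g.koszul · Y Z x) x where
  smul {f X} hf hX := by
    simp only [koszul, pair_smul_left, mvfderiv_mul hf (g.mdifferentiableAt_pair hX hZ),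
      mvfderiv_mul hf (g.mdifferentiableAt_pair hX hY), mlieBracket_smul_left hf hX]
    simp [pair]
    rw [g.symm x (X x) (Z x), g.symm x (X x) (Y x)]
    ring
  add {X X'} hX hX' := by
    simp only [koszul, pair_add_left,
      mvfderiv_add (g.mdifferentiableAt_pair hX hZ) (g.mdifferentiableAt_pair hX' hZ),
      mvfderiv_add (g.mdifferentiableAt_pair hX hY) (g.mdifferentiableAt_pair hX' hY),
      mlieBracket_add_left hX hX']
    simp
    ring

lemma tensorialAt_koszul_right {x : M} {X Y : Π x : M, TangentSpace (𝓡 n) x}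
    (hX : FieldDiffAt X x) (hY : FieldDiffAt Y x) :
    TensorialAt (𝓡 n) (EuclideanSpace ℝ (Fin n)) (g.koszul X Y · x) x where
  smul {f Z} hf hZ := by
    simp only [koszul, pair_smul_right, mvfderiv_mul hf (g.mdifferentiableAt_pair hX hZ),
      mvfderiv_mul hf (g.mdifferentiableAt_pair hY hZ), mlieBracket_smul_right hf hZ]
    simp [pair]
    rw [g.symm x (Z x) (Y x), g.symm x (Z x) (X x)]
    ring
  add {Z Z'} hZ hZ' := by
    simp only [koszul, pair_add_right,
      mvfderiv_add (g.mdifferentiableAt_pair hX hZ) (g.mdifferentiableAt_pair hX hZ'),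
      mvfderiv_add (g.mdifferentiableAt_pair hY hZ) (g.mdifferentiableAt_pair hY hZ'),
      mlieBracket_add_right hZ hZ']
    simp
    ring

/-- For a vector field `Y` differentiable at `x`, the bilinear form
`(v, w) ↦ 2 g(∇_v Y, w)` on the tangent space at `x`. -/
def koszulForm {x : M} {Y : Π x : M, TangentSpace (𝓡 n) x} (hY : FieldDiffAt Y x) :
    TangentSpace (𝓡 n) x →L[ℝ] TangentSpace (𝓡 n) x →L[ℝ] ℝ :=
  TensorialAt.mkHom₂ (F := EuclideanSpace ℝ (Fin n)) (F' := EuclideanSpace ℝ (Fin n))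
    (I := 𝓡 n) (V := fun y : M ↦ TangentSpace (𝓡 n) y) (V' := fun y : M ↦ TangentSpace (𝓡 n) y)
    (fun X Z ↦ g.koszul X Y Z x) x
    (fun _ hZ ↦ g.tensorialAt_koszul_left hY hZ) (fun _ hX ↦ g.tensorialAt_koszul_right hX hY)

lemma koszulForm_apply {x : M} {X Y Z : Π x : M, TangentSpace (𝓡 n) x}
    (hX : FieldDiffAt X x) (hY : FieldDiffAt Y x) (hZ : FieldDiffAt Z x) :
    g.koszulForm hY (X x) (Z x) = g.koszul X Y Z x :=
  TensorialAt.mkHom₂_apply _ _ hX hZ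

open Classical in
/-- The underlying function of the Levi-Civita connection: `∇_v Y = ½ (koszul form (v, ·))♯`.
It takes the value `0` at the points where `Y` is not differentiable. -/
def leviCivitaFun (Y : Π x : M, TangentSpace (𝓡 n) x) (x : M) :
    TangentSpace (𝓡 n) x →L[ℝ] TangentSpace (𝓡 n) x :=
  if hY : FieldDiffAt Y x then (2⁻¹ : ℝ) • (g.sharp x ∘L g.koszulForm hY) else 0

/-- The Koszul formula, which determines `leviCivitaFun`. -/
lemma two_mul_inner_leviCivitaFun {x : M} {X Y Z : Π x : M, TangentSpace (𝓡 n) x}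
    (hX : FieldDiffAt X x) (hY : FieldDiffAt Y x) (hZ : FieldDiffAt Z x) :
    2 * g.inner x (g.leviCivitaFun Y x (X x)) (Z x) = g.koszul X Y Z x := by
  rw [leviCivitaFun, dif_pos hY]
  simp [g.inner_sharp, g.koszulForm_apply hX hY hZ]

lemma leviCivitaFun_ext {x : M} {A B : TangentSpace (𝓡 n) x →L[ℝ] TangentSpace (𝓡 n) x}
    (h : ∀ X Z : Π x : M, TangentSpace (𝓡 n) x, FieldDiffAt X x → FieldDiffAt Z x →
      2 * g.inner x (A (X x)) (Z x) = 2 * g.inner x (B (X x)) (Z x)) : A = B := by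
  ext1 v
  refine g.ext_inner fun w ↦ ?_
  have := h (extend (EuclideanSpace ℝ (Fin n)) v) (extend (EuclideanSpace ℝ (Fin n)) w)
    (mdifferentiableAt_extend ..) (mdifferentiableAt_extend ..)
  simpa using this

/-- The Levi-Civita connection of a semi-Riemannian metric. In Mathlib's argument order,
`g.leviCivita Y x v` is `∇_v Y`. -/
def leviCivita :
    CovariantDerivative (𝓡 n) (EuclideanSpace ℝ (Fin n)) (fun x : M ↦ TangentSpace (𝓡 n) x) where
  toFun := g.leviCivitaFun
  isCovariantDerivativeOnUniv :=
    { add := by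
        intro Y Y' x hY hY' _
        refine g.leviCivitaFun_ext fun X Z hX hZ ↦ ?_
        rw [g.two_mul_inner_leviCivitaFun hX (mdifferentiableAt_add_section hY hY') hZ]
        simp only [add_apply, map_add, mul_add,
          g.two_mul_inner_leviCivitaFun hX hY hZ, g.two_mul_inner_leviCivitaFun hX hY' hZ]
        simp only [koszul, pair_add_left, pair_add_right,
          mvfderiv_add (g.mdifferentiableAt_pair hY hZ) (g.mdifferentiableAt_pair hY' hZ),
          mvfderiv_add (g.mdifferentiableAt_pair hX hY) (g.mdifferentiableAt_pair hX hY'),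
          mlieBracket_add_left hY hY', mlieBracket_add_right hY hY']
        simp
        ring
      leibniz := by
        intro Y f x hY hf _
        refine g.leviCivitaFun_ext fun X Z hX hZ ↦ ?_
        rw [g.two_mul_inner_leviCivitaFun hX (hf.smul_section hY) hZ]
        have key := g.two_mul_inner_leviCivitaFun hX hY hZ
        simp only [koszul] at key
        simp only [koszul, pair_smul_left, pair_smul_right,
          mvfderiv_mul hf (g.mdifferentiableAt_pair hY hZ),
          mvfderiv_mul hf (g.mdifferentiableAt_pair hX hY),
          mlieBracket_smul_left hf hY, mlieBracket_smul_right hf hY]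
        simp [pair]
        rw [g.symm x (Y x) (X x)]
        linear_combination (-f x) * key }

lemma two_mul_inner_leviCivita {x : M} {X Y Z : Π x : M, TangentSpace (𝓡 n) x}
    (hX : FieldDiffAt X x) (hY : FieldDiffAt Y x) (hZ : FieldDiffAt Z x) :
    2 * g.inner x (g.leviCivita Y x (X x)) (Z x) = g.koszul X Y Z x :=
  g.two_mul_inner_leviCivitaFun hX hY hZ

lemma pair_comm (X Y : Π x : M, TangentSpace (𝓡 n) x) : g.pair X Y = g.pair Y X :=
  funext fun x ↦ g.symm x _ _

/-- The Levi-Civita connection is torsion free. -/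
lemma leviCivita_torsion : g.leviCivita.torsion = 0 := by
  rw [CovariantDerivative.torsion_eq_zero_iff]
  intro X Y x hX hY
  refine g.ext_inner fun w ↦ ?_
  have hW : FieldDiffAt (extend (EuclideanSpace ℝ (Fin n)) w) x := mdifferentiableAt_extend ..
  have h1 := g.two_mul_inner_leviCivita hX hY hW
  have h2 := g.two_mul_inner_leviCivita hY hX hW
  simp only [koszul, extend_apply_self] at h1 h2
  rw [g.pair_comm Y X, mlieBracket_swap_apply (V := Y) (W := X)] at h2
  simp only [map_neg, map_sub, neg_apply, sub_apply] at h2 ⊢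
  linear_combination (h1 - h2) / 2

/-- The Levi-Civita connection is compatible with the metric. -/
lemma mvfderiv_pair {x : M} {X Y Z : Π x : M, TangentSpace (𝓡 n) x}
    (hX : FieldDiffAt X x) (hY : FieldDiffAt Y x) (hZ : FieldDiffAt Z x) :
    mvfderiv (𝓡 n) (g.pair Y Z) x (X x) = g.inner x (g.leviCivita Y x (X x)) (Z x)
      + g.inner x (Y x) (g.leviCivita Z x (X x)) := by
  have h1 := g.two_mul_inner_leviCivita hX hY hZ
  have h2 := g.two_mul_inner_leviCivita hX hZ hY
  rw [g.symm x (Y x)]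
  simp only [koszul] at h1 h2
  rw [g.pair_comm Z Y, mlieBracket_swap_apply (V := Z) (W := Y)] at h2
  simp only [map_neg, neg_apply] at h2
  linear_combination -(h1 + h2) / 2

/-! ### Curvature -/

/-- The curvature `R(X, Y)Z = ∇_X ∇_Y Z - ∇_Y ∇_X Z - ∇_{[X, Y]} Z` of vector fields. -/
def curvature (X Y Z : Π x : M, TangentSpace (𝓡 n) x) (x : M) : TangentSpace (𝓡 n) x :=
  g.leviCivita (fun y ↦ g.leviCivita Z y (Y y)) x (X x)
    - g.leviCivita (fun y ↦ g.leviCivita Z y (X y)) x (Y x)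
    - g.leviCivita Z x (mlieBracket (𝓡 n) X Y x)

/-- The curvature tensor `R(u, v)w` of tangent vectors at `x`, computed with extensions of
`u`, `v`, `w` to vector fields that are smooth near `x`. -/
def curvatureAt (x : M) (u v w : TangentSpace (𝓡 n) x) : TangentSpace (𝓡 n) x :=
  g.curvature (extend (EuclideanSpace ℝ (Fin n)) u) (extend (EuclideanSpace ℝ (Fin n)) v)
    (extend (EuclideanSpace ℝ (Fin n)) w) x

/-- The Riemannian curvature tensor `R(u, v, w, z) = g(R(u, v)w, z)`. -/
def riemann (x : M) (u v w z : TangentSpace (𝓡 n) x) : ℝ :=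
  g.inner x (g.curvatureAt x u v w) z

/-- The coordinate basis of the tangent space at `x` (in the preferred chart at `x`). -/
def tangentBasis (x : M) : Module.Basis (Fin n) ℝ (TangentSpace (𝓡 n) x) :=
  (EuclideanSpace.basisFun (Fin n) ℝ).toBasis

/-- The Ricci tensor `Ric(v, w)`, the trace of `u ↦ R(u, v)w`. -/
def ricci (x : M) (v w : TangentSpace (𝓡 n) x) : ℝ :=
  ∑ i, (tangentBasis x).repr (g.curvatureAt x (tangentBasis x i) v w) i

/-- The matrix `(g_ij)` of the metric in the coordinate basis at `x`. -/
def gramMatrix (x : M) : Matrix (Fin n) (Fin n) ℝ :=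
  Matrix.of fun i j ↦ g.inner x (tangentBasis x i) (tangentBasis x j)

/-- The scalar curvature, the metric trace `∑ g^{ij} Ric_ij` of the Ricci tensor. -/
def scal (x : M) : ℝ :=
  ∑ i, ∑ j, (g.gramMatrix x)⁻¹ i j * g.ricci x (tangentBasis x i) (tangentBasis x j)

/-- The metric is Einstein: `Ric = (scal / n) g`. -/
def IsEinstein : Prop :=
  ∀ (x : M) (v w : TangentSpace (𝓡 n) x), g.ricci x v w = g.scal x / n * g.inner x v w

/-- The Schouten tensor `L = 1/(n-2) (scal/(2(n-1)) g - Ric)`. -/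
def schouten (x : M) (v w : TangentSpace (𝓡 n) x) : ℝ :=
  1 / ((n : ℝ) - 2) * (g.scal x / (2 * ((n : ℝ) - 1)) * g.inner x v w - g.ricci x v w)

/-- The Weyl tensor `W = R - g ⋆ L`, where `⋆` is the Kulkarni-Nomizu product
`(h ⋆ k)(a, b, c, d) = h(a, c) k(b, d) + h(b, d) k(a, c) - h(a, d) k(b, c) - h(b, c) k(a, d)`. -/
def weyl (x : M) (a b c d : TangentSpace (𝓡 n) x) : ℝ :=
  g.riemann x a b c d
    - (g.inner x a c * g.schouten x b d + g.inner x b d * g.schouten x a c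
      - g.inner x a d * g.schouten x b c - g.inner x b c * g.schouten x a d)

/-! ### Killing fields and derivatives of endomorphism fields -/

/-- `V` is a Killing vector field: the Lie derivative of the metric along `V` vanishes, i.e.
`V(g(X, Y)) = g([V, X], Y) + g(X, [V, Y])`. -/
def IsKilling (V : Π x : M, TangentSpace (𝓡 n) x) : Prop :=
  ∀ (x : M) (X Y : Π x : M, TangentSpace (𝓡 n) x), FieldDiffAt X x → FieldDiffAt Y x →
    mvfderiv (𝓡 n) (g.pair X Y) x (V x)
      = g.inner x (mlieBracket (𝓡 n) V X x) (Y x) + g.inner x (X x) (mlieBracket (𝓡 n) V Y x)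

/-- The covariant derivative `(∇_X A)(Y) = ∇_X (A(Y)) - A(∇_X Y)` at `x` of a field `A` of
endomorphisms of the tangent bundle, for a tangent vector `X` at `x` and a vector field `Y`. -/
def nablaEnd (A : Π x : M, TangentSpace (𝓡 n) x →L[ℝ] TangentSpace (𝓡 n) x) (x : M)
    (X : TangentSpace (𝓡 n) x) (Y : Π x : M, TangentSpace (𝓡 n) x) : TangentSpace (𝓡 n) x :=
  g.leviCivita (fun y ↦ A y (Y y)) x X - A x (g.leviCivita Y x X)

end SemiRiemannianMetric

end

open Filter Topology

noncomputable section

/-! Write k = scal/(n(n-1)). Since V is Killing, J = ∇V is skew-adjoint, and so is its covariant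
derivative. Antisymmetrising ∇J in its two vector arguments gives curvature (`nablaEnd_sub_swap`).
As in the Koszul formula, these two facts determine ∇J, and the first Bianchi identity turns the
result into Kostant's identity (∇_X J)(Y) = -R(V, X)Y (`IsKilling.inner_nablaEnd`). For an Einstein
metric the Schouten tensor is -(k/2)g, so where the Weyl tensor vanishes R has the form of constant
curvature k (`IsEinstein.riemann_eq_of_weyl_eq_zero`). Taking V as first argument gives the formula
for ∇J.

Constant length and skewness give J(V) = 0. The formula for ∇J at Y = V then reads -J²(X) = -k(X +
g(V, X)V).

Most of the work is the groundwork: smoothness of ∇_X Y, which allows it to be differentiated again,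
and the symmetries of R. -/

/-- The vector field `X` is smooth at `x`, as a section of the tangent bundle. -/
abbrev FieldSmoothAt {n : ℕ} {M : Type*} [TopologicalSpace M]
    [ChartedSpace (EuclideanSpace ℝ (Fin n)) M] [IsManifold (𝓡 n) ∞ M]
    (X : Π x : M, TangentSpace (𝓡 n) x) (x : M) : Prop :=
  ContMDiffAt (𝓡 n) ((𝓡 n).prod 𝓘(ℝ, EuclideanSpace ℝ (Fin n))) ∞
    (fun y ↦ TotalSpace.mk' (EuclideanSpace ℝ (Fin n))
      (E := fun y : M ↦ TangentSpace (𝓡 n) y) y (X y)) x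

/-- The function `Y(f)`, the derivative of `f` along the vector field `Y`. -/
def fieldDeriv {n : ℕ} {M : Type*} [TopologicalSpace M]
    [ChartedSpace (EuclideanSpace ℝ (Fin n)) M] [IsManifold (𝓡 n) ∞ M]
    (Y : Π x : M, TangentSpace (𝓡 n) x) (f : M → ℝ) : M → ℝ :=
  fun x ↦ mvfderiv (𝓡 n) f x (Y x)

/-! ### Smooth fields, derivatives along fields, Lie brackets. -/

section Smoothness

variable {n : ℕ} {M : Type*} [TopologicalSpace M]
  [ChartedSpace (EuclideanSpace ℝ (Fin n)) M] [IsManifold (𝓡 n) ∞ M]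
  {X Y : Π x : M, TangentSpace (𝓡 n) x} {f : M → ℝ} {x : M}

lemma FieldSmoothAt.diffAt (hX : FieldSmoothAt X x) : FieldDiffAt X x :=
  hX.mdifferentiableAt (by simp)

/-- Pointwise identities needing only differentiability thereby hold near `x`, and so can be
differentiated. The passage through C¹ is needed because only finite order of smoothness spreads to
a neighbourhood. -/
lemma FieldSmoothAt.eventually_diffAt (hX : FieldSmoothAt X x) :
    ∀ᶠ y in 𝓝 x, FieldDiffAt X y := by
  have h1 := (contMDiffAt_iff_contMDiffAt_nhds (n := 1) (by simp)).1
    (hX.of_le (by exact_mod_cast le_top))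
  exact h1.mono fun y hy ↦ hy.mdifferentiableAt one_ne_zero

lemma fieldSmoothAt_extend (v : TangentSpace (𝓡 n) x) :
    FieldSmoothAt (extend (EuclideanSpace ℝ (Fin n)) v) x :=
  contMDiffAt_extend ..

lemma FieldSmoothAt.smul (hf : ContMDiffAt (𝓡 n) 𝓘(ℝ) ∞ f x) (hX : FieldSmoothAt X x) :
    FieldSmoothAt (f • X) x :=
  ContMDiffAt.smul_section hf hX

lemma FieldSmoothAt.mlieBracket (hX : FieldSmoothAt X x) (hY : FieldSmoothAt Y x) :
    FieldSmoothAt (mlieBracket (𝓡 n) X Y) x := by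
  have : IsManifold (𝓡 n) ((⊤ : ℕ∞) + 1) M := by
    simpa using (inferInstance : IsManifold (𝓡 n) ∞ M)
  have : IsManifold (𝓡 n) (minSmoothness ℝ 2) M :=
    .of_le (n := ∞) (by simpa using WithTop.coe_le_coe.2 (le_top : (2 : ℕ∞) ≤ ⊤))
  exact ContMDiffAt.mlieBracket_vectorField (m := ⊤) (n := ⊤) hX hY (by simp)

lemma ContMDiffAt.fieldDeriv (hf : ContMDiffAt (𝓡 n) 𝓘(ℝ) ∞ f x) (hX : FieldSmoothAt X x) :
    ContMDiffAt (𝓡 n) 𝓘(ℝ) ∞ (fieldDeriv X f) x := by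
  have h1 := hf.mfderiv_const (m := ∞) (by simp)
  have h2 := ContMDiffAt.clm_apply_of_inCoordinates (E₁ := fun y : M ↦ TangentSpace (𝓡 n) y)
    (E₂ := fun y : ℝ ↦ TangentSpace 𝓘(ℝ) y) (F₁ := EuclideanSpace ℝ (Fin n)) (F₂ := ℝ)
    (b₁ := id) (b₂ := f) (v := X) (ϕ := fun y ↦ mfderiv (𝓡 n) 𝓘(ℝ) f y) h1 hX hf
  rw [contMDiffAt_totalSpace] at h2
  refine h2.2.congr_of_eventuallyEq (.of_forall fun y ↦ ?_)
  simp [_root_.fieldDeriv, mvfderiv]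
  rfl

lemma mlieBracket_smul_fieldDeriv {Z : Π x : M, TangentSpace (𝓡 n) x}
    (hf : MDifferentiableAt (𝓡 n) 𝓘(ℝ) f x) (hZ : FieldDiffAt Z x) :
    mlieBracket (𝓡 n) Y (f • Z) x = fieldDeriv Y f x • Z x + f x • mlieBracket (𝓡 n) Y Z x :=
  mlieBracket_smul_right hf hZ

/-- Differentiation along `[X, Y]` is the commutator of differentiation along `X` and `Y`. -/
lemma fieldDeriv_mlieBracket (hf : ContMDiffAt (𝓡 n) 𝓘(ℝ) ∞ f x)
    (hX : FieldSmoothAt X x) (hY : FieldSmoothAt Y x) :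
    fieldDeriv (mlieBracket (𝓡 n) X Y) f x
      = fieldDeriv X (fieldDeriv Y f) x - fieldDeriv Y (fieldDeriv X f) x := by
  rcases subsingleton_or_nontrivial (TangentSpace (𝓡 n) x) with h | h
  · simp [fieldDeriv, Subsingleton.elim (X x) 0, Subsingleton.elim (Y x) 0,
      Subsingleton.elim (mlieBracket (𝓡 n) X Y x) 0]
  -- The claim is read off from the coefficient of a nonzero vector in the Jacobi identity for X, Y,
  -- fZ.
  obtain ⟨v, hv⟩ := exists_ne (0 : TangentSpace (𝓡 n) x)
  set Z := extend (EuclideanSpace ℝ (Fin n)) v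
  have hZ : FieldSmoothAt Z x := fieldSmoothAt_extend v
  have hZx : Z x = v := by simp [Z]
  have hfe : ∀ᶠ y in 𝓝 x, MDifferentiableAt (𝓡 n) 𝓘(ℝ) f y :=
    ((contMDiffAt_iff_contMDiffAt_nhds (n := 1) (by simp)).1
      (hf.of_le (by exact_mod_cast le_top))).mono
      fun y hy ↦ hy.mdifferentiableAt one_ne_zero
  have expand : ∀ A B : Π x : M, TangentSpace (𝓡 n) x, FieldSmoothAt A x → FieldSmoothAt B x →
      mlieBracket (𝓡 n) A (mlieBracket (𝓡 n) B (f • Z)) x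
        = fieldDeriv A (fieldDeriv B f) x • v + fieldDeriv B f x • mlieBracket (𝓡 n) A Z x
          + (fieldDeriv A f x • mlieBracket (𝓡 n) B Z x
            + f x • mlieBracket (𝓡 n) A (mlieBracket (𝓡 n) B Z) x) := by
    intro A B hA hB
    have e : mlieBracket (𝓡 n) B (f • Z)
        =ᶠ[𝓝 x] fieldDeriv B f • Z + f • mlieBracket (𝓡 n) B Z := by
      filter_upwards [hfe, hZ.eventually_diffAt] with y h1 h2
      exact mlieBracket_smul_fieldDeriv h1 h2
    have hBf := hf.fieldDeriv hB
    have hBZ := hB.mlieBracket hZ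
    rw [(EventuallyEq.refl _ A).mlieBracket_vectorField_eq e,
      mlieBracket_add_right (hBf.smul_section hZ |>.mdifferentiableAt (by simp))
        (hf.smul_section hBZ |>.mdifferentiableAt (by simp)),
      mlieBracket_smul_fieldDeriv (hBf.mdifferentiableAt (by simp)) hZ.diffAt,
      mlieBracket_smul_fieldDeriv (hf.mdifferentiableAt (by simp)) hBZ.diffAt, hZx]
  have two_le : minSmoothness ℝ 2 ≤ ∞ := by
    simpa using WithTop.coe_le_coe.2 (le_top : (2 : ℕ∞) ≤ ⊤)
  have : IsManifold (𝓡 n) (minSmoothness ℝ 3) M :=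
    .of_le (n := ∞) (by simpa using WithTop.coe_le_coe.2 (le_top : (3 : ℕ∞) ≤ ⊤))
  have J := leibniz_identity_mlieBracket_apply (hX.of_le two_le) (hY.of_le two_le)
    ((hZ.smul hf).of_le two_le)
  have J' := leibniz_identity_mlieBracket_apply (hX.of_le two_le) (hY.of_le two_le)
    (hZ.of_le two_le)
  rw [expand X Y hX hY, expand Y X hY hX,
    mlieBracket_smul_fieldDeriv (hf.mdifferentiableAt (by simp)) hZ.diffAt, hZx, J'] at J
  -- After subtracting f times the Jacobi identity for X, Y, Z, the terms with one derivative of f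
  -- cancel in pairs, except the one along [X, Y].
  have key : (fieldDeriv (mlieBracket (𝓡 n) X Y) f x
      - (fieldDeriv X (fieldDeriv Y f) x - fieldDeriv Y (fieldDeriv X f) x)) • v = 0 := by
    rw [← sub_eq_zero] at J
    rw [← neg_eq_zero, ← J]
    module
  exact sub_eq_zero.1 ((smul_eq_zero.1 key).resolve_right hv)

end Smoothness

/-! ### Smoothness of determinants and inverse matrices. -/

section MatrixSmoothness

variable {n : ℕ} {M : Type*} [TopologicalSpace M]
  [ChartedSpace (EuclideanSpace ℝ (Fin n)) M] {ι : Type*} [Fintype ι] [DecidableEq ι]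
  {A : M → Matrix ι ι ℝ} {x : M}

lemma ContMDiffAt.matrix_det (hA : ∀ i j, ContMDiffAt (𝓡 n) 𝓘(ℝ) ∞ (fun y ↦ A y i j) x) :
    ContMDiffAt (𝓡 n) 𝓘(ℝ) ∞ (fun y ↦ (A y).det) x := by
  simp only [Matrix.det_apply]
  refine ContMDiffAt.sum fun σ _ ↦ ?_
  simp only [Units.smul_def, zsmul_eq_mul]
  exact contMDiffAt_const.mul (ContMDiffAt.prod fun i _ ↦ hA _ _)

/-- Cramer's rule: adjugate entries are determinants with one row replaced by a constant one. -/
lemma ContMDiffAt.matrix_inv (hA : ∀ i j, ContMDiffAt (𝓡 n) 𝓘(ℝ) ∞ (fun y ↦ A y i j) x)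
    (hx : (A x).det ≠ 0) (i j : ι) :
    ContMDiffAt (𝓡 n) 𝓘(ℝ) ∞ (fun y ↦ (A y)⁻¹ i j) x := by
  simp only [Matrix.inv_def, Ring.inverse_eq_inv', Matrix.smul_apply, smul_eq_mul,
    Matrix.adjugate_apply]
  refine ((ContMDiffAt.matrix_det hA).inv₀ hx).mul (ContMDiffAt.matrix_det fun k l ↦ ?_)
  by_cases hk : k = j
  · simpa [hk] using contMDiffAt_const
  · simpa [Matrix.updateRow_ne hk] using hA k l

end MatrixSmoothness

/-! ### Smoothness of the Levi-Civita connection. -/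

namespace SemiRiemannianMetric

variable {n : ℕ} {M : Type*} [TopologicalSpace M]
  [ChartedSpace (EuclideanSpace ℝ (Fin n)) M] [IsManifold (𝓡 n) ∞ M]
  (g : SemiRiemannianMetric n M) {X Y Z W : Π x : M, TangentSpace (𝓡 n) x} {x : M}

lemma contMDiffAt_pair (hX : FieldSmoothAt X x) (hY : FieldSmoothAt Y x) :
    ContMDiffAt (𝓡 n) 𝓘(ℝ) ∞ (g.pair X Y) x := by
  have := ContMDiffAt.clm_bundle_apply₂ (F₁ := EuclideanSpace ℝ (Fin n))
    (F₂ := EuclideanSpace ℝ (Fin n)) (F₃ := ℝ) (E₃ := Bundle.Trivial M ℝ) (g.contMDiff x) hX hY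
  simp only [contMDiffAt_totalSpace] at this
  exact this.2

/-- The Gram matrix of a basis of a tangent space is invertible. -/
lemma det_gram_ne_zero {ι : Type*} [Fintype ι] [DecidableEq ι]
    (b : Module.Basis ι ℝ (TangentSpace (𝓡 n) x)) :
    (Matrix.of fun i j ↦ g.inner x (b i) (b j)).det ≠ 0 := by
  convert (LinearMap.BilinForm.nondegenerate_iff_det_ne_zero b).1 (g.bilin_nondegenerate x)
  ext i j
  rw [LinearMap.BilinForm.toMatrix_apply]
  rfl

/-- A vector field is smooth as soon as its products with smooth vector fields are. -/
lemma fieldSmoothAt_of_pair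
    (h : ∀ Z : Π x : M, TangentSpace (𝓡 n) x, FieldSmoothAt Z x →
      ContMDiffAt (𝓡 n) 𝓘(ℝ) ∞ (g.pair W Z) x) : FieldSmoothAt W x := by
  set e := trivializationAt (EuclideanSpace ℝ (Fin n)) (fun y : M ↦ TangentSpace (𝓡 n) y) x
  set b := (EuclideanSpace.basisFun (Fin n) ℝ).toBasis
  have hx : x ∈ e.baseSet := FiberBundle.mem_baseSet_trivializationAt' x
  have hs := e.isLocalFrameOn_localFrame_baseSet (𝓡 n) ∞ b
  have hE : ∀ i, FieldSmoothAt (e.localFrame b i) x := fun i ↦ hs.contMDiffAt e.open_baseSet hx i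
  set A : M → Matrix (Fin n) (Fin n) ℝ :=
    fun y ↦ Matrix.of fun i j ↦ g.inner y (e.localFrame b i y) (e.localFrame b j y)
  have hdet : ∀ y ∈ e.baseSet, (A y).det ≠ 0 := by
    intro y hy
    have := g.det_gram_ne_zero (hs.toBasisAt hy)
    simpa [A] using this
  refine hs.contMDiffAt_of_coeff (fun i ↦ ?_) (e.open_baseSet.mem_nhds hx)
  -- The frame coefficients of W are the inverse Gram matrix applied to the products g(W, E_j).
  have hsm : ContMDiffAt (𝓡 n) 𝓘(ℝ) ∞
      (fun y ↦ ∑ j, (A y)⁻¹ i j * g.pair W (e.localFrame b j) y) x :=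
    ContMDiffAt.sum fun j _ ↦ (ContMDiffAt.matrix_inv
      (fun k l ↦ g.contMDiffAt_pair (hE k) (hE l)) (hdet x hx) i j).mul (h _ (hE j))
  refine hsm.congr_of_eventuallyEq ?_
  filter_upwards [e.open_baseSet.mem_nhds hx] with y hy
  set c : Fin n → ℝ := fun i ↦ hs.coeff i y (W y)
  have hW : W y = ∑ k, c k • e.localFrame b k y := hs.coeff_sum_eq W hy
  have hp : (fun j ↦ g.pair W (e.localFrame b j) y) = (A y).mulVec c := by
    ext j
    rw [pair, hW]
    simp only [map_sum, map_smul, Matrix.mulVec, dotProduct, A, Matrix.of_apply,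
      sum_apply, smul_eq_mul, smul_apply]
    refine Finset.sum_congr rfl fun k _ ↦ ?_
    rw [g.symm y (e.localFrame b k y), mul_comm]
  have : ((A y)⁻¹.mulVec fun j ↦ g.pair W (e.localFrame b j) y) = c := by
    rw [hp, Matrix.mulVec_mulVec, Matrix.nonsing_inv_mul _ (isUnit_iff_ne_zero.2 (hdet y hy)),
      Matrix.one_mulVec]
  exact (congrFun this i).symm

/-- The covariant derivative of smooth vector fields is smooth. -/
lemma fieldSmoothAt_leviCivita (hX : FieldSmoothAt X x) (hY : FieldSmoothAt Y x) :
    FieldSmoothAt (fun y ↦ g.leviCivita Y y (X y)) x := by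
  refine g.fieldSmoothAt_of_pair fun Z hZ ↦ ?_
  have hsm : ContMDiffAt (𝓡 n) 𝓘(ℝ) ∞ (fun y ↦ 2⁻¹ * g.koszul X Y Z y) x :=
    contMDiffAt_const.mul <| ((((((g.contMDiffAt_pair hY hZ).fieldDeriv hX).add
      ((g.contMDiffAt_pair hX hZ).fieldDeriv hY)).sub
      ((g.contMDiffAt_pair hX hY).fieldDeriv hZ)).add
      (g.contMDiffAt_pair (hX.mlieBracket hY) hZ)).sub
      (g.contMDiffAt_pair (hX.mlieBracket hZ) hY)).sub
      (g.contMDiffAt_pair (hY.mlieBracket hZ) hX)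
  refine hsm.congr_of_eventuallyEq ?_
  filter_upwards [hX.eventually_diffAt, hY.eventually_diffAt, hZ.eventually_diffAt]
    with y h1 h2 h3
  rw [← g.two_mul_inner_leviCivita h1 h2 h3]
  simp [pair]

lemma leviCivita_congr (hY : FieldDiffAt Y x) (hZ : FieldDiffAt Z x) (h : Y =ᶠ[𝓝 x] Z) :
    g.leviCivita Y x = g.leviCivita Z x :=
  g.leviCivita.isCovariantDerivativeOn.congr_of_eventuallyEq hY hZ univ_mem h

lemma leviCivita_add (hY : FieldDiffAt Y x) (hZ : FieldDiffAt Z x) :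
    g.leviCivita (Y + Z) x = g.leviCivita Y x + g.leviCivita Z x :=
  g.leviCivita.isCovariantDerivativeOnUniv.add hY hZ

lemma leviCivita_smul {f : M → ℝ} (hf : MDifferentiableAt (𝓡 n) 𝓘(ℝ) f x)
    (hY : FieldDiffAt Y x) (v : TangentSpace (𝓡 n) x) :
    g.leviCivita (f • Y) x v = f x • g.leviCivita Y x v + mvfderiv (𝓡 n) f x v • Y x := by
  have := g.leviCivita.isCovariantDerivativeOnUniv.leibniz hY hf
  simp [this]

lemma leviCivita_sub_swap (hX : FieldDiffAt X x) (hY : FieldDiffAt Y x) :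
    g.leviCivita Y x (X x) - g.leviCivita X x (Y x) = mlieBracket (𝓡 n) X Y x :=
  (CovariantDerivative.torsion_eq_zero_iff _).1 g.leviCivita_torsion hX hY

end SemiRiemannianMetric

lemma fieldDeriv_congr {n : ℕ} {M : Type*} [TopologicalSpace M]
    [ChartedSpace (EuclideanSpace ℝ (Fin n)) M] [IsManifold (𝓡 n) ∞ M]
    {X : Π x : M, TangentSpace (𝓡 n) x} {f f' : M → ℝ} {x : M} (h : f =ᶠ[𝓝 x] f') :
    fieldDeriv X f x = fieldDeriv X f' x := by
  simp only [fieldDeriv, mvfderiv, h.mfderiv_eq]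
  rfl

/-! ### Iterated covariant derivatives and the symmetries of curvature. -/

namespace SemiRiemannianMetric

variable {n : ℕ} {M : Type*} [TopologicalSpace M]
  [ChartedSpace (EuclideanSpace ℝ (Fin n)) M] [IsManifold (𝓡 n) ∞ M]
  (g : SemiRiemannianMetric n M) {X Y Z W : Π x : M, TangentSpace (𝓡 n) x} {x : M}

/-- The vector field `∇_X Y`. -/
def nabla (X Y : Π x : M, TangentSpace (𝓡 n) x) : Π x : M, TangentSpace (𝓡 n) x :=
  fun x ↦ g.leviCivita Y x (X x)

lemma fieldSmoothAt_nabla (hX : FieldSmoothAt X x) (hY : FieldSmoothAt Y x) :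
    FieldSmoothAt (g.nabla X Y) x :=
  g.fieldSmoothAt_leviCivita hX hY

lemma fieldDeriv_pair (hX : FieldDiffAt X x) (hY : FieldDiffAt Y x) (hZ : FieldDiffAt Z x) :
    fieldDeriv X (g.pair Y Z) x = (g.pair (g.nabla X Y) Z + g.pair Y (g.nabla X Z)) x :=
  g.mvfderiv_pair hX hY hZ

lemma eventuallyEq_fieldDeriv_pair (hX : FieldSmoothAt X x) (hY : FieldSmoothAt Y x)
    (hZ : FieldSmoothAt Z x) :
    fieldDeriv X (g.pair Y Z) =ᶠ[𝓝 x] g.pair (g.nabla X Y) Z + g.pair Y (g.nabla X Z) := by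
  filter_upwards [hX.eventually_diffAt, hY.eventually_diffAt, hZ.eventually_diffAt]
    with y h1 h2 h3
  exact g.fieldDeriv_pair h1 h2 h3

/-- Metric compatibility produces a sum of two pairings; this is the form needed to differentiate it
again. -/
lemma fieldDeriv_pair_add (hX : FieldDiffAt X x) {Y' Z' : Π x : M, TangentSpace (𝓡 n) x}
    (hY : FieldDiffAt Y x) (hZ : FieldDiffAt Z x) (hY' : FieldDiffAt Y' x)
    (hZ' : FieldDiffAt Z' x) :
    fieldDeriv X (g.pair Y Z + g.pair Y' Z') x
      = g.pair (g.nabla X Y) Z x + g.pair Y (g.nabla X Z) x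
        + (g.pair (g.nabla X Y') Z' x + g.pair Y' (g.nabla X Z') x) := by
  have h : fieldDeriv X (g.pair Y Z + g.pair Y' Z') x
      = fieldDeriv X (g.pair Y Z) x + fieldDeriv X (g.pair Y' Z') x := by
    simp [fieldDeriv, mvfderiv_add (g.mdifferentiableAt_pair hY hZ)
      (g.mdifferentiableAt_pair hY' hZ')]
  rw [h, g.fieldDeriv_pair hX hY hZ, g.fieldDeriv_pair hX hY' hZ']
  rfl

lemma eventuallyEq_nabla_sub_nabla (hX : FieldSmoothAt X x) (hY : FieldSmoothAt Y x) :
    g.nabla X Y =ᶠ[𝓝 x] mlieBracket (𝓡 n) X Y + g.nabla Y X := by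
  filter_upwards [hX.eventually_diffAt, hY.eventually_diffAt] with y h1 h2
  rw [Pi.add_apply, ← g.leviCivita_sub_swap h1 h2]
  exact (sub_add_cancel _ _).symm

/-! ### Symmetries of the curvature -/

lemma curvature_eq (X Y Z : Π x : M, TangentSpace (𝓡 n) x) (x : M) :
    g.curvature X Y Z x = g.nabla X (g.nabla Y Z) x - g.nabla Y (g.nabla X Z) x
      - g.nabla (mlieBracket (𝓡 n) X Y) Z x :=
  rfl

lemma curvature_swap (X Y Z : Π x : M, TangentSpace (𝓡 n) x) (x : M) :
    g.curvature X Y Z x = -g.curvature Y X Z x := by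
  simp only [curvature_eq, nabla]
  rw [mlieBracket_swap_apply (V := X) (W := Y), map_neg]
  abel

/-- The curvature operator `R(X, Y)` is skew-adjoint. -/
lemma inner_curvature_skew (hX : FieldSmoothAt X x) (hY : FieldSmoothAt Y x)
    (hZ : FieldSmoothAt Z x) (hW : FieldSmoothAt W x) :
    g.inner x (g.curvature X Y Z x) (W x) = -g.inner x (g.curvature X Y W x) (Z x) := by
  have second : ∀ A B : Π x : M, TangentSpace (𝓡 n) x, FieldSmoothAt A x → FieldSmoothAt B x →
      fieldDeriv A (fieldDeriv B (g.pair Z W)) x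
        = g.pair (g.nabla A (g.nabla B Z)) W x + g.pair (g.nabla B Z) (g.nabla A W) x
          + (g.pair (g.nabla A Z) (g.nabla B W) x + g.pair Z (g.nabla A (g.nabla B W)) x) := by
    intro A B hA hB
    rw [fieldDeriv_congr (g.eventuallyEq_fieldDeriv_pair hB hZ hW),
      g.fieldDeriv_pair_add hA.diffAt (g.fieldSmoothAt_nabla hB hZ).diffAt hW.diffAt
        hZ.diffAt (g.fieldSmoothAt_nabla hB hW).diffAt]
  -- In the commutator of second derivatives of g(Z, W) the mixed terms g(∇Z, ∇W) cancel; what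
  -- remains is g(R(X,Y)Z, W) + g(Z, R(X,Y)W) = 0.
  have h := fieldDeriv_mlieBracket (g.contMDiffAt_pair hZ hW) hX hY
  rw [second X Y hX hY, second Y X hY hX,
    g.fieldDeriv_pair (hX.mlieBracket hY).diffAt hZ.diffAt hW.diffAt] at h
  simp only [Pi.add_apply, pair] at h
  rw [g.symm x (g.curvature X Y W x)]
  simp only [curvature_eq, map_sub, sub_apply]
  linear_combination -h

/-- The first Bianchi identity. -/
lemma curvature_bianchi (hX : FieldSmoothAt X x) (hY : FieldSmoothAt Y x)
    (hZ : FieldSmoothAt Z x) :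
    g.curvature X Y Z x + g.curvature Y Z X x + g.curvature Z X Y x = 0 := by
  have two_le : minSmoothness ℝ 2 ≤ ∞ := by
    simpa using WithTop.coe_le_coe.2 (le_top : (2 : ℕ∞) ≤ ⊤)
  have : IsManifold (𝓡 n) (minSmoothness ℝ 3) M :=
    .of_le (n := ∞) (by simpa using WithTop.coe_le_coe.2 (le_top : (3 : ℕ∞) ≤ ⊤))
  have jacobi := leibniz_identity_mlieBracket_apply (hX.of_le two_le) (hY.of_le two_le)
    (hZ.of_le two_le)
  -- Torsion-freeness is used twice, for the pairs B, C and A, [B, C]. The cyclic sum of the left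
  -- sides is that of the curvatures, and that of the right sides vanishes by Jacobi.
  have step : ∀ A B C : Π x : M, TangentSpace (𝓡 n) x, FieldSmoothAt A x → FieldSmoothAt B x →
      FieldSmoothAt C x → g.nabla A (g.nabla B C) x - g.nabla A (g.nabla C B) x
        - g.nabla (mlieBracket (𝓡 n) B C) A x
          = mlieBracket (𝓡 n) A (mlieBracket (𝓡 n) B C) x := by
    intro A B C hA hB hC
    have hBC := hB.mlieBracket hC
    have hCB := g.fieldSmoothAt_nabla hC hB
    rw [← g.leviCivita_sub_swap hA.diffAt hBC.diffAt, nabla, g.leviCivita_congr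
      (g.fieldSmoothAt_nabla hB hC).diffAt (mdifferentiableAt_add_section hBC.diffAt hCB.diffAt)
      (g.eventuallyEq_nabla_sub_nabla hB hC), g.leviCivita_add hBC.diffAt hCB.diffAt]
    simp [nabla]
  have e1 := step X Y Z hX hY hZ
  have e2 := step Y Z X hY hZ hX
  have e3 := step Z X Y hZ hX hY
  have b1 : mlieBracket (𝓡 n) Y (mlieBracket (𝓡 n) Z X) x
      = -mlieBracket (𝓡 n) Y (mlieBracket (𝓡 n) X Z) x := by
    rw [mlieBracket_swap (V := Z), mlieBracket_swap_apply, mlieBracket_swap_apply (V := Y),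
      ← neg_one_smul ℝ (mlieBracket (𝓡 n) X Z), mlieBracket_const_smul_left
      (hX.mlieBracket hZ).diffAt]
    simp
  rw [mlieBracket_swap_apply (V := mlieBracket (𝓡 n) X Y)] at jacobi
  rw [b1] at e2
  have : g.curvature X Y Z x + g.curvature Y Z X x + g.curvature Z X Y x
      = mlieBracket (𝓡 n) X (mlieBracket (𝓡 n) Y Z) x
        + -mlieBracket (𝓡 n) Y (mlieBracket (𝓡 n) X Z) x
        + mlieBracket (𝓡 n) Z (mlieBracket (𝓡 n) X Y) x := by
    rw [← e1, ← e2, ← e3]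
    simp only [curvature_eq]
    abel
  rw [this, jacobi]
  abel

lemma riemann_swap_left (a b c d : TangentSpace (𝓡 n) x) :
    g.riemann x a b c d = -g.riemann x b a c d := by
  rw [riemann, curvatureAt, curvature_swap]
  simp [riemann, curvatureAt]

lemma riemann_swap_right (a b c d : TangentSpace (𝓡 n) x) :
    g.riemann x a b c d = -g.riemann x a b d c := by
  simpa [riemann, curvatureAt] using g.inner_curvature_skew (fieldSmoothAt_extend a)
    (fieldSmoothAt_extend b) (fieldSmoothAt_extend c) (fieldSmoothAt_extend d)

lemma riemann_bianchi (a b c d : TangentSpace (𝓡 n) x) :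
    g.riemann x a b c d + g.riemann x b c a d + g.riemann x c a b d = 0 := by
  have := congrArg (fun v ↦ g.inner x v d) (g.curvature_bianchi (fieldSmoothAt_extend a)
    (fieldSmoothAt_extend b) (fieldSmoothAt_extend c))
  simpa [riemann, curvatureAt] using this

/-- In a signed sum of four Bianchi identities, one for each vector held in the last slot, skewness
cancels all but 2R(a,b,c,d) - 2R(c,d,a,b). -/
lemma riemann_pair_symm (a b c d : TangentSpace (𝓡 n) x) :
    g.riemann x a b c d = g.riemann x c d a b := by
  have s := g.riemann_swap_left (x := x)
  have t := g.riemann_swap_right (x := x)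
  linarith [g.riemann_bianchi a b c d, g.riemann_bianchi b c d a, g.riemann_bianchi c d a b,
    g.riemann_bianchi d a b c, t b c d a, t a b d c, t c d b a, t d a c b, s a c d b, t c a d b,
    s d b c a, t b d c a]

end SemiRiemannianMetric

namespace SemiRiemannianMetric

variable {n : ℕ} {M : Type*} [TopologicalSpace M]
  [ChartedSpace (EuclideanSpace ℝ (Fin n)) M] [IsManifold (𝓡 n) ∞ M]
  (g : SemiRiemannianMetric n M) {V X Y Z : Π x : M, TangentSpace (𝓡 n) x} {x : M}

/-! ### Covariant derivatives of `∇V` -/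

lemma nablaEnd_leviCivita (V X Y : Π x : M, TangentSpace (𝓡 n) x) (x : M) :
    g.nablaEnd (g.leviCivita V) x (X x) Y
      = g.nabla X (g.nabla Y V) x - g.leviCivita V x (g.nabla X Y x) :=
  rfl

/-- The Ricci identity: by torsion-freeness, ∇_{[X,Y]}V is ∇V applied to ∇_X Y - ∇_Y X. -/
lemma nablaEnd_sub_swap (hX : FieldSmoothAt X x) (hY : FieldSmoothAt Y x) :
    g.nablaEnd (g.leviCivita V) x (X x) Y - g.nablaEnd (g.leviCivita V) x (Y x) X
      = g.curvature X Y V x := by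
  rw [nablaEnd_leviCivita, nablaEnd_leviCivita, curvature_eq]
  have h : g.nabla (mlieBracket (𝓡 n) X Y) V x
      = g.leviCivita V x (g.nabla X Y x) - g.leviCivita V x (g.nabla Y X x) := by
    rw [nabla, ← g.leviCivita_sub_swap hX.diffAt hY.diffAt, map_sub]
    rfl
  rw [h]
  abel

/-- The covariant derivative of a vector field, applied to a vector field that is merely
differentiable at a point, is differentiable at this point. -/
lemma fieldDiffAt_leviCivita (hV : FieldSmoothAt V x) (hY : FieldDiffAt Y x) :
    FieldDiffAt (fun y ↦ g.leviCivita V y (Y y)) x := by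
  set e := trivializationAt (EuclideanSpace ℝ (Fin n)) (fun y : M ↦ TangentSpace (𝓡 n) y) x
  set b := (EuclideanSpace.basisFun (Fin n) ℝ).toBasis
  have hx : x ∈ e.baseSet := FiberBundle.mem_baseSet_trivializationAt' x
  have hE : ∀ i, FieldSmoothAt (e.localFrame b i) x := fun i ↦
    (e.isLocalFrameOn_localFrame_baseSet (𝓡 n) ∞ b).contMDiffAt e.open_baseSet hx i
  -- In a smooth frame, Y has differentiable coefficients c_i and ∇_Y V = ∑ c_i ∇_{E_i} V, which
  -- involves no derivative of Y.
  have hsum : FieldDiffAt (fun y ↦ ∑ i, e.localFrameCoeff (𝓡 n) b i y (Y y)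
      • g.leviCivita V y (e.localFrame b i y)) x :=
    MDifferentiableAt.sum_section fun i _ ↦
      (mdifferentiableAt_localFrameCoeff b hx hY i).smul_section
      (g.fieldSmoothAt_leviCivita (hE i) hV).diffAt
  refine hsum.congr_of_eventuallyEq ?_
  filter_upwards [e.eventually_eq_localFrame_sum_coeff_smul (I := 𝓡 n) b (s := Y) hx] with y hy
  congr 1
  conv_lhs => rw [hy]
  simp only [map_sum, map_smul]

/-- `(∇_v (∇V))(Y)` depends only on the value of `Y` at the point under consideration. -/
lemma nablaEnd_leviCivita_congr (hV : FieldSmoothAt V x) (v : TangentSpace (𝓡 n) x)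
    (hY : FieldDiffAt Y x) (hZ : FieldDiffAt Z x) (h : Y x = Z x) :
    g.nablaEnd (g.leviCivita V) x v Y = g.nablaEnd (g.leviCivita V) x v Z := by
  have tens : TensorialAt (𝓡 n) (EuclideanSpace ℝ (Fin n))
      (fun Y ↦ g.nablaEnd (g.leviCivita V) x v Y) x :=
    { smul := by
        intro f Y hf hY
        have e : (fun y ↦ g.leviCivita V y ((f • Y) y))
            = f • fun y ↦ g.leviCivita V y (Y y) := by
          ext1 y
          simp
        simp only [nablaEnd]
        -- Both halves of `nablaEnd` contribute the same term v(f) ∇_Y V, which cancels.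
        rw [e, g.leviCivita_smul hf (g.fieldDiffAt_leviCivita hV hY), g.leviCivita_smul hf hY]
        simp only [map_add, map_smul, smul_sub]
        abel
      add := by
        intro Y Y' hY hY'
        have e : (fun y ↦ g.leviCivita V y ((Y + Y') y))
            = (fun y ↦ g.leviCivita V y (Y y)) + fun y ↦ g.leviCivita V y (Y' y) := by
          ext1 y
          simp
        simp only [nablaEnd]
        rw [e, g.leviCivita_add (g.fieldDiffAt_leviCivita hV hY)
          (g.fieldDiffAt_leviCivita hV hY'), g.leviCivita_add hY hY']
        simp only [map_add, add_apply]
        abel }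
  exact tens.pointwise hY hZ h

/-! ### Killing fields -/

variable {g}

/-- The covariant derivative of a Killing field is skew-adjoint. -/
lemma IsKilling.inner_leviCivita (hK : g.IsKilling V) (hV : FieldDiffAt V x)
    (v w : TangentSpace (𝓡 n) x) :
    g.inner x (g.leviCivita V x v) w + g.inner x v (g.leviCivita V x w) = 0 := by
  set X := extend (EuclideanSpace ℝ (Fin n)) v
  set Y := extend (EuclideanSpace ℝ (Fin n)) w
  have hX : FieldDiffAt X x := (fieldSmoothAt_extend v).diffAt
  have hY : FieldDiffAt Y x := (fieldSmoothAt_extend w).diffAt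
  have h := hK x X Y hX hY
  rw [g.mvfderiv_pair hV hX hY, ← g.leviCivita_sub_swap hV hX, ← g.leviCivita_sub_swap hV hY] at h
  simp only [map_sub, sub_apply, X, Y, extend_apply_self] at h
  linarith

/-- A Killing field of constant length is geodesic. -/
lemma IsKilling.leviCivita_self (hK : g.IsKilling V) (hV : FieldSmoothAt V x) {c : ℝ}
    (hc : ∀ y, g.inner y (V y) (V y) = c) : g.leviCivita V x (V x) = 0 := by
  refine g.nondegenerate x _ fun w ↦ ?_
  have h := g.mvfderiv_pair (fieldSmoothAt_extend w).diffAt hV.diffAt hV.diffAt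
  have hp : g.pair V V = fun _ ↦ c := funext hc
  rw [hp, mvfderiv_const, g.symm x (g.leviCivita V x _)] at h
  simp only [zero_apply, extend_apply_self] at h
  have := hK.inner_leviCivita hV.diffAt (V x) w
  linarith

/-- Differentiate g(JY, Z) + g(Y, JZ) = 0 along X; skewness of J itself removes the terms with ∇_X Y
and ∇_X Z. -/
lemma IsKilling.inner_nablaEnd_skew (hK : g.IsKilling V) (hV : ∀ y, FieldSmoothAt V y)
    (hX : FieldSmoothAt X x) (hY : FieldSmoothAt Y x) (hZ : FieldSmoothAt Z x) :
    g.inner x (g.nablaEnd (g.leviCivita V) x (X x) Y) (Z x)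
      = -g.inner x (g.nablaEnd (g.leviCivita V) x (X x) Z) (Y x) := by
  have h0 : g.pair (g.nabla Y V) Z + g.pair Y (g.nabla Z V) = fun _ ↦ 0 :=
    funext fun y ↦ hK.inner_leviCivita (hV y).diffAt (Y y) (Z y)
  have h := g.fieldDeriv_pair_add hX.diffAt (g.fieldSmoothAt_nabla hY (hV x)).diffAt hZ.diffAt
    hY.diffAt (g.fieldSmoothAt_nabla hZ (hV x)).diffAt
  rw [h0, fieldDeriv, mvfderiv_const] at h
  have k1 := hK.inner_leviCivita (hV x).diffAt (g.nabla X Y x) (Z x)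
  have k2 := hK.inner_leviCivita (hV x).diffAt (Y x) (g.nabla X Z x)
  rw [g.symm x _ (Y x), nablaEnd_leviCivita, nablaEnd_leviCivita]
  simp only [map_sub, sub_apply, zero_apply, pair] at h ⊢
  have e1 : g.nabla Z V x = g.leviCivita V x (Z x) := rfl
  have e2 : g.nabla Y V x = g.leviCivita V x (Y x) := rfl
  rw [e1, e2] at h
  linarith

/-- Kostant's identity `∇²_{X, Y} V = -R(V, X) Y` for a Killing field `V`. -/
lemma IsKilling.inner_nablaEnd (hK : g.IsKilling V) (hV : ∀ y, FieldSmoothAt V y)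
    (a b c : TangentSpace (𝓡 n) x) :
    g.inner x (g.nablaEnd (g.leviCivita V) x a (extend (EuclideanSpace ℝ (Fin n)) b)) c
      = -g.riemann x (V x) a b c := by
  set A : TangentSpace (𝓡 n) x → TangentSpace (𝓡 n) x → TangentSpace (𝓡 n) x → ℝ :=
    fun a b c ↦
      g.inner x (g.nablaEnd (g.leviCivita V) x a (extend (EuclideanSpace ℝ (Fin n)) b)) c
  have skew : ∀ a b c, A a b c = -A a c b := by
    intro a b c
    simpa [A] using hK.inner_nablaEnd_skew hV (fieldSmoothAt_extend a) (fieldSmoothAt_extend b)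
      (fieldSmoothAt_extend c)
  have comm : ∀ a b c, A a b c - A b a c = -g.riemann x a b c (V x) := by
    intro a b c
    have h1 := congrArg (fun v ↦ g.inner x v c) (g.nablaEnd_sub_swap (V := V)
      (fieldSmoothAt_extend a) (fieldSmoothAt_extend b))
    -- Skewness moves the field V out of the differentiated slot, so only its value at `x` matters
    -- and `riemann`, defined through extensions, applies.
    have h2 := g.inner_curvature_skew (fieldSmoothAt_extend a) (fieldSmoothAt_extend b)
      (hV x) (fieldSmoothAt_extend c)
    simp only [extend_apply_self, map_sub, sub_apply] at h1 h2
    rw [h2] at h1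
    exact h1
  change A a b c = _
  -- The combination comm(a,b,c) - comm(b,c,a) + comm(c,a,b) has left side 2A(a,b,c); by Bianchi its
  -- right side is 2R(b,c,a,V) = -2R(V,a,b,c).
  linarith [skew a b c, skew b c a, skew c a b, comm a b c, comm b c a, comm c a b,
    g.riemann_bianchi a b c (V x), g.riemann_swap_right b c a (V x),
    g.riemann_pair_symm b c (V x) a]

/-! ### Curvature of Einstein metrics whose Weyl tensor is annihilated by a vector -/

lemma IsEinstein.schouten_eq (hE : g.IsEinstein) (hn : 3 ≤ n) (v w : TangentSpace (𝓡 n) x) :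
    g.schouten x v w = -(g.scal x / (n * (n - 1))) / 2 * g.inner x v w := by
  have h : (3 : ℝ) ≤ n := by exact_mod_cast hn
  have h0 : (n : ℝ) ≠ 0 := by linarith
  have h1 : (n : ℝ) - 1 ≠ 0 := by linarith
  have h2 : (n : ℝ) - 2 ≠ 0 := by linarith
  rw [schouten, hE]
  field_simp
  ring

/-- The Schouten part of R is then -(k/2) g ⋆ g. Vanishing is required only on the given quadruple,
so quadruples starting with V are covered. -/
lemma IsEinstein.riemann_eq_of_weyl_eq_zero (hE : g.IsEinstein) (hn : 3 ≤ n)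
    {a b c d : TangentSpace (𝓡 n) x} (hW : g.weyl x a b c d = 0) :
    g.riemann x a b c d = g.scal x / (n * (n - 1))
      * (g.inner x b c * g.inner x a d - g.inner x a c * g.inner x b d) := by
  rw [weyl] at hW
  simp only [hE.schouten_eq hn] at hW
  linear_combination hW

end SemiRiemannianMetric

end

theorem lemmal52 {n : ℕ} (hn : 3 ≤ n) {M : Type*} [TopologicalSpace M]
    [ChartedSpace (EuclideanSpace ℝ (Fin n)) M] [IsManifold (𝓡 n) ∞ M]
    (g : SemiRiemannianMetric n M) (hLorentz : g.IsLorentzian) (hEinstein : g.IsEinstein)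
    (V : Π x : M, TangentSpace (𝓡 n) x)
    (hV : ContMDiff (𝓡 n) ((𝓡 n).prod 𝓘(ℝ, EuclideanSpace ℝ (Fin n))) ∞
      (fun x ↦ TotalSpace.mk' (EuclideanSpace ℝ (Fin n))
        (E := fun x : M ↦ TangentSpace (𝓡 n) x) x (V x)))
    (hKilling : g.IsKilling V)
    (hunit : ∀ x, g.inner x (V x) (V x) = -1)
    (hWeyl : ∀ (x : M) (a b c : TangentSpace (𝓡 n) x), g.weyl x (V x) a b c = 0)
    (J : Π x : M, TangentSpace (𝓡 n) x →L[ℝ] TangentSpace (𝓡 n) x)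
    (hJ : ∀ (x : M) (X : TangentSpace (𝓡 n) x), J x X = g.leviCivita V x X) :
    (∀ x, J x (V x) = 0) ∧
    (∀ (x : M) (X : TangentSpace (𝓡 n) x),
      J x (J x X) = (g.scal x / (n * (n - 1))) • (X + g.inner x (V x) X • V x)) ∧
    (∀ (x : M) (X : TangentSpace (𝓡 n) x) (Y : Π x : M, TangentSpace (𝓡 n) x),
      FieldDiffAt Y x →
      g.nablaEnd J x X Y
        = (g.scal x / (n * (n - 1))) • (g.inner x (V x) (Y x) • X - g.inner x X (Y x) • V x)) := by
  obtain rfl : J = g.leviCivita V := funext fun x ↦ ContinuousLinearMap.ext (hJ x)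
  have hV' : ∀ y, FieldSmoothAt V y := fun y ↦ hV y
  have geodesic : ∀ x, g.leviCivita V x (V x) = 0 := fun x ↦ hKilling.leviCivita_self (hV x) hunit
  have deriv : ∀ (x : M) (X : TangentSpace (𝓡 n) x) (Y : Π x : M, TangentSpace (𝓡 n) x),
      FieldDiffAt Y x → g.nablaEnd (g.leviCivita V) x X Y = (g.scal x / (n * (n - 1)))
        • (g.inner x (V x) (Y x) • X - g.inner x X (Y x) • V x) := by
    intro x X Y hY
    -- Y is only differentiable at `x`; a smooth extension of its value replaces it.
    rw [g.nablaEnd_leviCivita_congr (hV' x) X hY (fieldSmoothAt_extend (Y x)).diffAt (by simp)]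
    refine g.ext_inner fun w ↦ ?_
    rw [hKilling.inner_nablaEnd hV', hEinstein.riemann_eq_of_weyl_eq_zero hn (hWeyl x X (Y x) w)]
    simp only [map_smul, map_sub, smul_apply, sub_apply, smul_eq_mul]
    ring
  refine ⟨geodesic, fun x X ↦ ?_, deriv⟩
  -- With Y = V the term ∇_X(J(V)) vanishes, leaving -J²(X).
  have h := deriv x X V (hV' x).diffAt
  have h0 : (fun y ↦ g.leviCivita V y (V y)) = 0 := funext geodesic
  rw [SemiRiemannianMetric.nablaEnd, h0, CovariantDerivative.zero, hunit, g.symm x X] at h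
  rw [← neg_inj, ← smul_neg]
  simpa [sub_eq_add_neg, add_comm] using h
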